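/- Let $n>1$ be odd, and let $C\ell(n)$ be the real Clifford algebra generated by $\mathbf e_1,\dots,\mathbf e_n$ with $\mathbf e_i\mathbf e_j+\mathbf e_j\mathbf e_i=-2\delta_{ij}$. Identify $(x_0,\dots,x_n)\in\mathbb R^{n+1}$ with the paravector $x=x_0+\mathbf x$, $\mathbf x=\sum_i x_i\mathbf e_i$, and put $\bar x=x_0-\mathbf x$. Let $$P_k^n(x)=\sum_{s=0}^k T_s^k\,x^{k-s}\bar x^{\,s},\qquad T_s^k=\frac{k!}{(n)_k}\,\frac{\left(\frac{n+1}2\right)_{k-s}\left(\frac{n-1}2\right)_s}{(k-s)!\,s!},$$ where $(a)_j=a(a+1)\cdots(a+j-1)$, be the monogenic Appell polynomials with $P_k^n(1)=1$. Let $f:\mathbb C\to\mathbb C$ be an entire function whose Taylor coefficients $a_k$ at $0$ are real, and write $f(w+\mathrm iy)=u(w,y)+\mathrm i\,v(w,y)$ with $u,v$ real. For a real constant $\alpha\neq0$, the Fueter–Sce extension of $f$ with normalization constant $\alpha$ is $$\tau_n[f](x)=\alpha\,\Delta^{\frac{n-1}2}\Big(u(x_0,|\mathbf x|)+\frac{\mathbf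 x}{|\mathbf x|}\,v(x_0,|\mathbf x|)\Big),$$ where $\Delta$ is the Laplacian of $\mathbb R^{n+1}$ and the function in parentheses is extended continuously to $\mathbf x=0$. Then the series defining the Appell extension $\eta_n[f](x)=\sum_{k=0}^\infty a_kP_k^n(x)$ converges for every paravector $x$, and the following holds. (i) For every real $\alpha\ne0$, the equality $\tau_n[f](x)=\eta_n[f](x)$ holds for all paravectors $x$ if and only if $$a_{k+n-1}=\frac{\gamma_n[f]\,k!}{(k+n-1)!}\,a_k\qquad\text{for all }k\ge0,$$ where $\gamma_n[f]=(-1)^{\frac{n-1}2}\dfrac{(n-2)!!}{(n-1)!!\,\alpha}$, which does not depend on $k$. (ii) Consequently, there is a real $\alpha\neq0$ with $\tau_n[f]=\eta_n[f]$ on all paravectors if and only if there is a real constant $\gamma_n[f]\ne0$, independent of $k$, such that this recurrence holds for all $k\ge0$. -/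

import Mathlib

namespace FueterSce

/-- The negative definite quadratic form `v ↦ -∑ vᵢ²` on `ℝⁿ`. -/
noncomputable def negSq (n : ℕ) : QuadraticForm ℝ (Fin n → ℝ) :=
  QuadraticMap.weightedSumSquares ℝ (fun _ : Fin n => (-1 : ℝ))

/-- The real Clifford algebra `Cℓ(n)`, with `eᵢ eⱼ + eⱼ eᵢ = -2 δᵢⱼ`. -/
abbrev Cl (n : ℕ) : Type := CliffordAlgebra (negSq n)

/-- The canonical topology of the finite-dimensional real vector space `Cℓ(n)`. -/
noncomputable instance instTopologicalSpaceCl (n : ℕ) : TopologicalSpace (Cl n) :=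
  moduleTopology ℝ (Cl n)

instance instIsModuleTopologyCl (n : ℕ) : IsModuleTopology ℝ (Cl n) := ⟨rfl⟩

/-- The topology of `Cℓ(n)` is Hausdorff, so sums of series are unique. -/
instance instT2SpaceCl (n : ℕ) : T2Space (Cl n) := by
  refine T2Space.mk fun x y hxy => ?_
  obtain ⟨φ, hφ⟩ : ∃ φ : Module.Dual ℝ (Cl n), φ (x - y) ≠ 0 := by
    by_contra! h
    exact hxy (sub_eq_zero.1 ((Module.forall_dual_apply_eq_zero_iff ℝ (x - y)).1 h))
  have hc : Continuous φ := IsModuleTopology.continuous_of_linearMap φ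
  have hne : φ x ≠ φ y := fun h => hφ (by rw [map_sub, h, sub_self])
  obtain ⟨U, V, hU, hV, hx, hy, hd⟩ := t2_separation hne
  exact ⟨φ ⁻¹' U, φ ⁻¹' V, hU.preimage hc, hV.preimage hc, hx, hy, hd.preimage φ⟩

/-- The vector part `𝐱 = (x₁, …, xₙ)` of `x = (x₀, x₁, …, xₙ)`. -/
noncomputable def vecPart {n : ℕ} (x : EuclideanSpace ℝ (Fin (n + 1))) :
    EuclideanSpace ℝ (Fin n) :=
  WithLp.toLp 2 (fun i : Fin n => x i.succ)

/-- The embedding of `ℝⁿ⁺¹` in `Cℓ(n)` as paravectors, `x ↦ x₀ + 𝐱`. -/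
noncomputable def para {n : ℕ} (x : EuclideanSpace ℝ (Fin (n + 1))) : Cl n :=
  algebraMap ℝ (Cl n) (x 0) + CliffordAlgebra.ι (negSq n) (vecPart x).ofLp

/-- The conjugate paravector `x₀ - 𝐱`. -/
noncomputable def paraConj {n : ℕ} (x : EuclideanSpace ℝ (Fin (n + 1))) : Cl n :=
  algebraMap ℝ (Cl n) (x 0) - CliffordAlgebra.ι (negSq n) (vecPart x).ofLp

/-- The coefficients `T_s^k = (k! / (n)_k) ((n+1)/2)_{k-s} ((n-1)/2)_s / ((k-s)! s!)` of the Appell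
polynomials, where `(a)_j` is the rising factorial. -/
noncomputable def appellCoeff (n k s : ℕ) : ℝ :=
  (k.factorial : ℝ) / (ascPochhammer ℝ k).eval (n : ℝ)
    * ((ascPochhammer ℝ (k - s)).eval (((n : ℝ) + 1) / 2)
        * (ascPochhammer ℝ s).eval (((n : ℝ) - 1) / 2))
    / ((k - s).factorial * s.factorial)

/-- The Appell polynomial `P_k^n(x) = ∑_{s ≤ k} T_s^k x^{k-s} x̄^s` of a paravector variable. -/
noncomputable def appell (n k : ℕ) (x : EuclideanSpace ℝ (Fin (n + 1))) : Cl n :=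
  ∑ s ∈ Finset.range (k + 1), appellCoeff n k s • (para x ^ (k - s) * paraConj x ^ s)

/-- The Appell extension `η_n[f](x) = ∑ a_k P_k^n(x)` of the function with Taylor
coefficients `a`. -/
noncomputable def appellExt (n : ℕ) (a : ℕ → ℝ) (x : EuclideanSpace ℝ (Fin (n + 1))) : Cl n :=
  ∑' k : ℕ, a k • appell n k x

/-- The field `x ↦ u(x₀, |𝐱|) + ω(𝐱) v(x₀, |𝐱|)` with `f(w + iy) = u(w, y) + i v(w, y)` and
`ω(𝐱) = 𝐱 / |𝐱|`, written in the coordinates of the paravector space `ℝⁿ⁺¹`. At `𝐱 = 0` the second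
term is `0`, which is the continuous value when `f` is real on the real axis. -/
noncomputable def axialField (n : ℕ) (f : ℂ → ℂ) (x : EuclideanSpace ℝ (Fin (n + 1))) :
    EuclideanSpace ℝ (Fin (n + 1)) :=
  let F : ℂ := f (⟨x 0, ‖vecPart x‖⟩ : ℂ)
  WithLp.toLp 2 (Fin.cons F.re (fun i : Fin n => F.im * (vecPart x i / ‖vecPart x‖)))

/-- The Fueter–Sce extension `τ_n[f] = α Δ^{(n-1)/2} (u(x₀, |𝐱|) + ω(𝐱) v(x₀, |𝐱|))` for odd `n`,
with normalization constant `α`; here `Δ` is the Laplacian of `ℝⁿ⁺¹`. -/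
noncomputable def fueterSce (n : ℕ) (α : ℝ) (f : ℂ → ℂ) (x : EuclideanSpace ℝ (Fin (n + 1))) :
    Cl n :=
  α • para (((Laplacian.laplacian :
    (EuclideanSpace ℝ (Fin (n + 1)) → EuclideanSpace ℝ (Fin (n + 1))) →
      EuclideanSpace ℝ (Fin (n + 1)) → EuclideanSpace ℝ (Fin (n + 1)))^[(n - 1) / 2]
        (axialField n f)) x)

end FueterSce

/-!
Both extensions are sums of one family of axial power series, on which the Laplacian acts as a
shift of the coefficients.

Write `n = 2h + 1`, let `e` be the real unit of the paravector space, `p = ⟪e, x⟫ = x₀` and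
`q = ‖x‖²`. The polynomials `E_{j,m}` defined by
`∑ₘ E_{j,m}(x) tᵐ = (1 - t x̄) (1 - 2pt + qt²)⁻ʲ = (1 - t x)⁻ʲ (1 - t x̄)⁻⁽ʲ⁻¹⁾`
interpolate between the powers, `E_{1,m}(x) = xᵐ` (`gegenbauer_one_sub_mul_conj`), and the Appell
polynomials, `E_{h+1,m} = binom(m + 2h, 2h) P_m` (`para_axial_term`). The generating function is an
explicit function of the vector `x`, and a computation valid in any Euclidean space of dimension `N`
gives `Δ E_{j,m} = 2j(2j - N) E_{j+1,m-2}`. For rapidly decreasing coefficients `b` the derivatives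
may be taken term by term, so that `F_{j,b} = ∑ₘ bₘ E_{j,m}` satisfies
`Δ F_{j,b} = 2j(2j - N) F_{j+1,b'}` with `b'ₘ = b_{m+2}` (`laplacian_axialSeries`).

The axial field of `f` is `F_{1,a}` (`axialSeries_one`). For `N = n + 1`, after `h` Laplacians it
becomes `F_{h+1}` with coefficients `(-1)ʰ ((2h)‼)² a_{m+2h}`, while the Appell extension is
`F_{h+1}` with coefficients `aₘ / binom(m + 2h, 2h)` (`hasSum_smul_appell`). On the real axis
`F_{h+1,b}` is an ordinary power series whose `m`-th coefficient is a positive multiple of `bₘ`, so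
`F_{h+1,b}` determines `b` (`para_axialSeries_injective`), and the two extensions agree exactly when
the coefficients do. This is the recurrence (`recurrence_iff`).
-/

open InnerProductSpace
open scoped ComplexConjugate

namespace FueterSce

/-! ### Gegenbauer polynomials and their derivatives -/

/-- The Gegenbauer polynomials in homogeneous form: `gegenbauer p q j k` is the coefficient of
`t ^ (k - 2)` in `(1 - 2 p t + q t²)⁻ʲ`. The index is shifted by `2`, with value `0` at `k = 0, 1`,
so that no recursion has boundary terms. -/
noncomputable def gegenbauer (p q : ℝ) : ℕ → ℕ → ℝ
  | 0, k => if k = 2 then 1 else 0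
  | _ + 1, 0 => 0
  | _ + 1, 1 => 0
  | j + 1, k + 2 =>
    gegenbauer p q j (k + 2) + 2 * p * gegenbauer p q (j + 1) (k + 1) - q * gegenbauer p q (j + 1) k

namespace gegenbauer

@[simp] theorem apply_zero (p q : ℝ) (j : ℕ) : gegenbauer p q j 0 = 0 := by
  cases j <;> simp [gegenbauer]

@[simp] theorem apply_one (p q : ℝ) (j : ℕ) : gegenbauer p q j 1 = 0 := by
  cases j <;> simp [gegenbauer]

/-- Multiplication by `1 - 2 p t + q t²` lowers `j`. The truncated subtractions are harmless, since
the values at `0` and `1` vanish. -/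
theorem succ_eq (p q : ℝ) (j k : ℕ) :
    gegenbauer p q (j + 1) k = gegenbauer p q j k
      + 2 * p * gegenbauer p q (j + 1) (k - 1) - q * gegenbauer p q (j + 1) (k - 2) := by
  rcases k with _ | _ | k
  · simp
  · simp
  · simp [gegenbauer]

/-- A crude geometric bound; the ratio `8 (R + 1)` makes the recursion close up with one factor `2`
for each step in `j`. -/
theorem abs_le {p q R : ℝ} (hR : 0 ≤ R) (hp : |p| ≤ R) (hq : |q| ≤ R ^ 2) (j k : ℕ) :
    |gegenbauer p q j k| ≤ 2 ^ j * (8 * (R + 1)) ^ k := by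
  set G := 8 * (R + 1) with hG
  have hG1 : 1 ≤ G := by linarith
  induction j generalizing k with
  | zero =>
    simp only [gegenbauer]
    split_ifs
    · simpa using one_le_pow₀ hG1
    · simp; positivity
  | succ j ihj =>
    induction k using Nat.twoStepInduction with
    | zero => simp
    | one => simp; positivity
    | more k ih0 ih1 =>
      have h := ihj (k + 2)
      have h1 : |2 * p * gegenbauer p q (j + 1) (k + 1)| ≤ 2 * R * (2 ^ (j + 1) * G ^ (k + 1)) := by
        rw [abs_mul, abs_mul, abs_two]
        gcongr
      have h0 : |q * gegenbauer p q (j + 1) k| ≤ R ^ 2 * (2 ^ (j + 1) * G ^ k) := by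
        rw [abs_mul]
        gcongr
      have htri : |gegenbauer p q (j + 1) (k + 2)| ≤ 2 ^ j * G ^ (k + 2)
          + 2 * R * (2 ^ (j + 1) * G ^ (k + 1)) + R ^ 2 * (2 ^ (j + 1) * G ^ k) := by
        rw [gegenbauer]
        exact (abs_sub _ _).trans (add_le_add ((abs_add_le _ _).trans (add_le_add h h1)) h0)
      refine htri.trans ?_
      have key : G ^ 2 + 4 * R * G + 2 * R ^ 2 ≤ 2 * G ^ 2 := by rw [hG]; nlinarith
      calc _ = (2 ^ j * G ^ k) * (G ^ 2 + 4 * R * G + 2 * R ^ 2) := by ring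
        _ ≤ (2 ^ j * G ^ k) * (2 * G ^ 2) := by gcongr
        _ = _ := by ring

variable {E : Type*} [NormedAddCommGroup E] [InnerProductSpace ℝ E]

/-- Coefficientwise form of `D Q⁻ʲ = -j Q⁻ʲ⁻¹ DQ` for `Q = 1 - 2 t ⟪e, x⟫ + t² ‖x‖²`. -/
theorem hasFDerivAt (e x : E) (j k : ℕ) :
    HasFDerivAt (fun y : E => gegenbauer ⟪e, y⟫_ℝ (‖y‖ ^ 2) j k)
      ((2 * j * gegenbauer ⟪e, x⟫_ℝ (‖x‖ ^ 2) (j + 1) (k - 1)) • innerSL ℝ e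
        - (2 * j * gegenbauer ⟪e, x⟫_ℝ (‖x‖ ^ 2) (j + 1) (k - 2)) • innerSL ℝ x) x := by
  induction j generalizing k with
  | zero =>
    simp only [gegenbauer]
    simpa using hasFDerivAt_const _ x
  | succ j ihj =>
    induction k using Nat.twoStepInduction with
    | zero => simpa using hasFDerivAt_const (0 : ℝ) x
    | one => simpa using hasFDerivAt_const (0 : ℝ) x
    | more k ih0 ih1 =>
      have hp : HasFDerivAt (fun y : E => ⟪e, y⟫_ℝ) (innerSL ℝ e) x := (innerSL ℝ e).hasFDerivAt
      have hq : HasFDerivAt (fun y : E => ‖y‖ ^ 2) (2 • innerSL ℝ x) x :=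
        (hasStrictFDerivAt_norm_sq x).hasFDerivAt
      have h := (((ihj (k + 2)).add ((hp.const_mul 2).mul ih1)).sub (hq.mul ih0))
      have hfun : (fun y : E => gegenbauer ⟪e, y⟫_ℝ (‖y‖ ^ 2) (j + 1) (k + 2)) =
          fun y => gegenbauer ⟪e, y⟫_ℝ (‖y‖ ^ 2) j (k + 2)
            + 2 * ⟪e, y⟫_ℝ * gegenbauer ⟪e, y⟫_ℝ (‖y‖ ^ 2) (j + 1) (k + 1)
            - ‖y‖ ^ 2 * gegenbauer ⟪e, y⟫_ℝ (‖y‖ ^ 2) (j + 1) k := by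
        funext y; rw [gegenbauer]
      rw [hfun]
      refine h.congr_fderiv ?_
      ext v
      -- The recursion at index `j + 2` expands the claimed derivative into the product rule terms.
      have r1 := succ_eq ⟪e, x⟫_ℝ (‖x‖ ^ 2) (j + 1) (k + 1)
      have r2 := succ_eq ⟪e, x⟫_ℝ (‖x‖ ^ 2) (j + 1) k
      simp only [Nat.add_sub_cancel, show k + 1 - 2 = k - 1 by omega,
        show k + 2 - 1 = k + 1 by omega]
        at r1 ⊢
      simp only [add_apply, sub_apply,
        smul_apply, innerSL_apply_apply, smul_eq_mul, nsmul_eq_mul]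
      push_cast
      rw [r1, r2]
      ring

end gegenbauer

/-! ### Axial power series -/

/-- Coefficients of an entire power series: `∑ |bₘ| Rᵐ` converges for every `R`. -/
def RapidDecay (b : ℕ → ℝ) : Prop := ∀ R : ℝ, 0 < R → Summable fun m => |b m| * R ^ m

/-- The sequence `m ↦ b (m + i)`. -/
def shift (i : ℕ) (b : ℕ → ℝ) : ℕ → ℝ := fun m => b (m + i)

@[simp] theorem shift_shift (i k : ℕ) (b : ℕ → ℝ) : shift i (shift k b) = shift (i + k) b := by
  funext m; simp [shift, add_assoc]

theorem RapidDecay.shift {b : ℕ → ℝ} (hb : RapidDecay b) (i : ℕ) : RapidDecay (shift i b) := by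
  intro R hR
  refine (((summable_nat_add_iff i).2 (hb R hR)).mul_right (R ^ i)⁻¹).congr fun m => ?_
  simp only [FueterSce.shift, pow_add]
  field_simp

section

variable {E : Type*} [NormedAddCommGroup E] [InnerProductSpace ℝ E]

theorem abs_gegenbauer_inner_le {e x : E} (he : ‖e‖ = 1) {R : ℝ} (hx : ‖x‖ ≤ R) (j k : ℕ) :
    |gegenbauer ⟪e, x⟫_ℝ (‖x‖ ^ 2) j k| ≤ 2 ^ j * (8 * (R + 1)) ^ k := by
  have hR : 0 ≤ R := (norm_nonneg x).trans hx
  refine gegenbauer.abs_le hR ?_ ?_ j k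
  · exact (abs_real_inner_le_norm e x).trans (by rwa [he, one_mul])
  · rw [abs_of_nonneg (by positivity)]
    gcongr

theorem RapidDecay.summable_bound {b : ℕ → ℝ} (hb : RapidDecay b) {R : ℝ} (hR : 0 ≤ R) (j i : ℕ) :
    Summable fun m => |b m| * (2 ^ j * (8 * (R + 1)) ^ (m + i)) := by
  refine ((hb (8 * (R + 1)) (by positivity)).mul_right (2 ^ j * (8 * (R + 1)) ^ i)).congr
    fun m => ?_
  rw [pow_add]; ring

theorem RapidDecay.summable_mul {b : ℕ → ℝ} (hb : RapidDecay b) {e : E} (he : ‖e‖ = 1)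
    (x : E) (j i : ℕ) :
    Summable fun m => b m * gegenbauer ⟪e, x⟫_ℝ (‖x‖ ^ 2) j (m + i) := by
  refine Summable.of_norm_bounded (hb.summable_bound (norm_nonneg x) j i) fun m => ?_
  rw [Real.norm_eq_abs, abs_mul]
  gcongr
  exact abs_gegenbauer_inner_le he le_rfl j _

/-- The series `∑ₘ bₘ [tᵐ] (1 - 2 t ⟪e, x⟫ + t² ‖x‖²)⁻ʲ`. -/
noncomputable def gegSeries (e : E) (j : ℕ) (b : ℕ → ℝ) (x : E) : ℝ :=
  ∑' m, b m * gegenbauer ⟪e, x⟫_ℝ (‖x‖ ^ 2) j (m + 2)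

/-- Multiplying the generating function by `t` amounts to shifting the coefficients `b`. -/
theorem gegSeries_shift_one {b : ℕ → ℝ} (hb : RapidDecay b) {e : E} (he : ‖e‖ = 1)
    (j : ℕ) (x : E) :
    HasSum (fun m => b m * gegenbauer ⟪e, x⟫_ℝ (‖x‖ ^ 2) j (m + 1))
      (gegSeries e j (shift 1 b) x) := by
  rw [← hasSum_nat_add_iff' 1]
  simpa [shift, gegSeries] using ((hb.shift 1).summable_mul he x j 2).hasSum

theorem gegSeries_shift_two {b : ℕ → ℝ} (hb : RapidDecay b) {e : E} (he : ‖e‖ = 1)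
    (j : ℕ) (x : E) :
    HasSum (fun m => b m * gegenbauer ⟪e, x⟫_ℝ (‖x‖ ^ 2) j m)
      (gegSeries e j (shift 2 b) x) := by
  rw [← hasSum_nat_add_iff' 2]
  simpa [shift, gegSeries, Finset.sum_range_succ] using ((hb.shift 2).summable_mul he x j 2).hasSum

theorem hasSum_gegSeries {b : ℕ → ℝ} (hb : RapidDecay b) {e : E} (he : ‖e‖ = 1)
    (j : ℕ) (x : E) :
    HasSum (fun m => b m * gegenbauer ⟪e, x⟫_ℝ (‖x‖ ^ 2) j (m + 2)) (gegSeries e j b x) :=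
  (hb.summable_mul he x j 2).hasSum

theorem gegSeries_eq {b : ℕ → ℝ} (hb : RapidDecay b) {e : E} (he : ‖e‖ = 1)
    (j : ℕ) (x : E) :
    gegSeries e j b x = gegSeries e (j + 1) b x
      - 2 * ⟪e, x⟫_ℝ * gegSeries e (j + 1) (shift 1 b) x
      + ‖x‖ ^ 2 * gegSeries e (j + 1) (shift 2 b) x := by
  refine (hasSum_gegSeries hb he j x).unique ?_
  refine (((hasSum_gegSeries hb he (j + 1) x).sub
    ((gegSeries_shift_one hb he (j + 1) x).mul_left (2 * ⟪e, x⟫_ℝ))).add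
    ((gegSeries_shift_two hb he (j + 1) x).mul_left (‖x‖ ^ 2))).congr_fun ?_
  intro m
  rw [gegenbauer]
  ring

theorem hasFDerivAt_gegSeries {b : ℕ → ℝ} (hb : RapidDecay b) {e : E} (he : ‖e‖ = 1)
    (j : ℕ) (x : E) :
    HasFDerivAt (gegSeries e j b)
      ((2 * j * gegSeries e (j + 1) (shift 1 b) x) • innerSL ℝ e
        - (2 * j * gegSeries e (j + 1) (shift 2 b) x) • innerSL ℝ x) x := by
  set R : ℝ := ‖x‖ + 1 with hR
  have hR0 : 0 ≤ R := by positivity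
  have hx : x ∈ Metric.ball (0 : E) R := by simp [hR]
  have hu : Summable fun m => 2 * (j : ℝ) * (|b m| * (2 ^ (j + 1) * (8 * (R + 1)) ^ (m + 1)))
      + 2 * (j : ℝ) * R * (|b m| * (2 ^ (j + 1) * (8 * (R + 1)) ^ (m + 0))) :=
    ((hb.summable_bound hR0 (j + 1) 1).mul_left _).add
      ((hb.summable_bound hR0 (j + 1) 0).mul_left _)
  have key := hasFDerivAt_tsum_of_isPreconnected hu Metric.isOpen_ball
    (convex_ball (0 : E) R).isPreconnected
    (fun m y _ => (gegenbauer.hasFDerivAt e y j (m + 2)).const_mul (b m)) ?_ hx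
    (hb.summable_mul he x j 2) hx
  · refine key.congr_fderiv (HasSum.tsum_eq ?_)
    have h1 := ((gegSeries_shift_one hb he (j + 1) x).mul_left (2 * (j : ℝ))).smul_const
      (innerSL ℝ e)
    have h2 := ((gegSeries_shift_two hb he (j + 1) x).mul_left (2 * (j : ℝ))).smul_const
      (innerSL ℝ x)
    refine (h1.sub h2).congr_fun fun m => ?_
    simp only [smul_sub, smul_smul, Nat.add_sub_cancel, show m + 2 - 1 = m + 1 by omega]
    congr 2 <;> ring
  · intro m y hy
    have hy' : ‖y‖ ≤ R := by simpa using (mem_ball_zero_iff.1 hy).le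
    have g1 := abs_gegenbauer_inner_le he hy' (j + 1) (m + 1)
    have g0 := abs_gegenbauer_inner_le he hy' (j + 1) m
    simp only [Nat.add_sub_cancel, show m + 2 - 1 = m + 1 by omega, smul_sub, smul_smul]
    refine (norm_sub_le _ _).trans (add_le_add ?_ ?_)
    · rw [norm_smul, innerSL_apply_norm, he, mul_one, Real.norm_eq_abs, abs_mul, abs_mul, abs_mul,
        abs_two, Nat.abs_cast]
      calc _ = 2 * (j : ℝ) * (|b m| * |gegenbauer ⟪e, y⟫_ℝ (‖y‖ ^ 2) (j + 1) (m + 1)|) := by ring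
        _ ≤ _ := by gcongr
    · rw [norm_smul, innerSL_apply_norm, Real.norm_eq_abs, abs_mul, abs_mul, abs_mul,
        abs_two, Nat.abs_cast]
      calc _ = 2 * (j : ℝ) * ‖y‖ * (|b m| * |gegenbauer ⟪e, y⟫_ℝ (‖y‖ ^ 2) (j + 1) m|) := by ring
        _ ≤ _ := by gcongr; exact g0

/-- Reflection in the line of a unit vector `e`; for the real unit of the paravector space it is the
conjugation `x ↦ x̄`. -/
noncomputable def reflect (e : E) : E →L[ℝ] E :=
  (2 : ℝ) • (innerSL ℝ e).smulRight e - ContinuousLinearMap.id ℝ E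

theorem reflect_apply (e x : E) : reflect e x = (2 * ⟪e, x⟫_ℝ) • e - x := by
  simp [reflect, smul_smul]

/-- The series `∑ₘ bₘ [tᵐ] (1 - t x̄) (1 - 2 t ⟪e, x⟫ + t² ‖x‖²)⁻ʲ`, where the unit vector `e` plays
the role of `1` and `x̄ = reflect e x`. -/
noncomputable def axialSeries (e : E) (j : ℕ) (b : ℕ → ℝ) (x : E) : E :=
  gegSeries e j b x • e - gegSeries e j (shift 1 b) x • reflect e x

theorem hasFDerivAt_axialSeries {b : ℕ → ℝ} (hb : RapidDecay b) {e : E} (he : ‖e‖ = 1)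
    (j : ℕ) (x : E) :
    HasFDerivAt (axialSeries e j b)
      ((2 * j : ℝ) • ((innerSL ℝ e).smulRight (axialSeries e (j + 1) (shift 1 b) x)
        - (innerSL ℝ x).smulRight (axialSeries e (j + 1) (shift 2 b) x))
        - gegSeries e j (shift 1 b) x • reflect e) x := by
  have h := ((hasFDerivAt_gegSeries hb he j x).smul_const e).sub
    ((hasFDerivAt_gegSeries (hb.shift 1) he j x).smul (reflect e).hasFDerivAt)
  refine h.congr_fderiv ?_
  ext v
  simp only [axialSeries, add_apply, sub_apply, smul_apply, innerSL_apply_apply, smul_eq_mul,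
    ContinuousLinearMap.smulRight_apply, shift_shift, Nat.reduceAdd]
  module

/-! ### The Laplacian of an axial series -/

/-- On axial series the Laplacian raises `j` and shifts the coefficients by two. In terms of
`y = e - t x` the generating function is `|y|⁻²ʲ ȳ`, and `Δ (|y|⁻²ʲ y) = 2j(2j - N) |y|⁻²ʲ⁻² y` in
dimension `N`. -/
theorem laplacian_axialSeries [FiniteDimensional ℝ E] {b : ℕ → ℝ} (hb : RapidDecay b) {e : E}
    (he : ‖e‖ = 1) (j : ℕ) :
    Laplacian.laplacian (axialSeries e j b) =
      (2 * j * (2 * j - Module.finrank ℝ E) : ℝ) • axialSeries e (j + 1) (shift 2 b) := by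
  funext x
  have hd : fderiv ℝ (axialSeries e j b) = fun y =>
      (2 * j : ℝ) • (ContinuousLinearMap.smulRightL ℝ E E (innerSL ℝ e)
          (axialSeries e (j + 1) (shift 1 b) y)
        - ContinuousLinearMap.smulRightL ℝ E E (innerSL ℝ y)
          (axialSeries e (j + 1) (shift 2 b) y))
        - gegSeries e j (shift 1 b) y • reflect e :=
    funext fun y => (hasFDerivAt_axialSeries hb he j y).fderiv
  -- The successive derivatives are explicit, so the second one is a bilinear product rule.
  have hF1 := hasFDerivAt_axialSeries (hb.shift 1) he (j + 1) x
  have hF2 := hasFDerivAt_axialSeries (hb.shift 2) he (j + 1) x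
  set T1 := (2 * (j + 1 : ℕ) : ℝ) • ((innerSL ℝ e).smulRight
    (axialSeries e (j + 1 + 1) (shift 1 (shift 1 b)) x)
        - (innerSL ℝ x).smulRight (axialSeries e (j + 1 + 1) (shift 2 (shift 1 b)) x))
        - gegSeries e (j + 1) (shift 1 (shift 1 b)) x • reflect e with hT1
  set T2 := (2 * (j + 1 : ℕ) : ℝ) • ((innerSL ℝ e).smulRight
    (axialSeries e (j + 1 + 1) (shift 1 (shift 2 b)) x)
        - (innerSL ℝ x).smulRight (axialSeries e (j + 1 + 1) (shift 2 (shift 2 b)) x))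
        - gegSeries e (j + 1) (shift 1 (shift 2 b)) x • reflect e with hT2
  have h2 := ((((ContinuousLinearMap.smulRightL ℝ E E (innerSL ℝ e)).hasFDerivAt.comp x hF1).sub
    ((ContinuousLinearMap.smulRightL ℝ E E).hasFDerivAt_of_bilinear
      (innerSL ℝ (E := E)).hasFDerivAt hF2)).const_smul (2 * j : ℝ)).sub
    ((hasFDerivAt_gegSeries (hb.shift 1) he j x).smul_const (reflect e))
  have hsecond : ∀ v : E, fderiv ℝ (fderiv ℝ (axialSeries e j b)) x v v =
      (2 * j : ℝ) • (⟪e, v⟫_ℝ • T1 v - (‖v‖ ^ 2) • axialSeries e (j + 1) (shift 2 b) x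
        - ⟪x, v⟫_ℝ • T2 v
        - (⟪e, v⟫_ℝ * gegSeries e (j + 1) (shift 2 b) x
          - ⟪x, v⟫_ℝ * gegSeries e (j + 1) (shift 3 b) x) • reflect e v) := by
    intro v
    rw [(h2.congr_of_eventuallyEq (Filter.EventuallyEq.of_eq hd)).fderiv]
    change (2 * j : ℝ) • (⟪e, v⟫_ℝ • T1 v
        - (⟪x, v⟫_ℝ • T2 v + ⟪v, v⟫_ℝ • axialSeries e (j + 1) (shift 2 b) x))
      - ((2 * j * gegSeries e (j + 1) (shift 1 (shift 1 b)) x) * ⟪e, v⟫_ℝ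
        - (2 * j * gegSeries e (j + 1) (shift 2 (shift 1 b)) x) * ⟪x, v⟫_ℝ) • reflect e v = _
    rw [real_inner_self_eq_norm_sq, shift_shift, shift_shift]
    module
  let B := stdOrthonormalBasis ℝ E
  have hsum : ∀ (T : E →L[ℝ] E) (y : E), ∑ i, ⟪y, B i⟫_ℝ • T (B i) = T y := fun T y => by
    conv_rhs => rw [← B.sum_repr' y, map_sum]
    simp [real_inner_comm]
  have hn : ∑ i, ‖B i‖ ^ 2 = (Module.finrank ℝ E : ℝ) := by simp
  rw [laplacian_eq_iteratedFDeriv_orthonormalBasis _ B, Pi.smul_apply]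
  simp only [iteratedFDeriv_two_apply, Matrix.cons_val_zero, Matrix.cons_val_one, hsecond, sub_smul,
    mul_comm _ (gegSeries _ _ _ _), mul_smul, ← Finset.smul_sum, Finset.sum_sub_distrib, hsum,
    ← Finset.sum_smul, hn]
  -- Rewriting the series of index `j + 1` by those of index `j + 2` leaves a linear identity in `e`
  -- and `x`.
  have r2 := gegSeries_eq (hb.shift 2) he (j + 1) x
  have r3 := gegSeries_eq (hb.shift 3) he (j + 1) x
  have hee : ⟪e, e⟫_ℝ = 1 := by rw [real_inner_self_eq_norm_sq, he, one_pow]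
  simp only [shift_shift, Nat.reduceAdd] at r2 r3 hT1 hT2
  simp only [hT1, hT2, axialSeries, sub_apply, smul_apply, innerSL_apply_apply,
    ContinuousLinearMap.smulRight_apply, shift_shift, Nat.reduceAdd, reflect_apply, hee,
    real_inner_self_eq_norm_sq, real_inner_comm, r2, r3]
  push_cast
  module

end

theorem RapidDecay.const_smul {b : ℕ → ℝ} (hb : RapidDecay b) (c : ℝ) : RapidDecay (c • b) := by
  intro R hR
  refine ((hb R hR).mul_left |c|).congr fun m => ?_
  rw [Pi.smul_apply, smul_eq_mul, abs_mul, mul_assoc]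

theorem axialSeries_smul {E : Type*} [NormedAddCommGroup E] [InnerProductSpace ℝ E] (e : E) (j : ℕ)
    (c : ℝ) (b : ℕ → ℝ) : axialSeries e j (c • b) = c • axialSeries e j b := by
  have h : ∀ (b : ℕ → ℝ) (x : E), gegSeries e j (c • b) x = c * gegSeries e j b x := fun b x => by
    simp only [gegSeries, ← tsum_mul_left, Pi.smul_apply, smul_eq_mul, mul_assoc]
  funext x
  have hs : shift 1 (c • b) = c • shift 1 b := rfl
  rw [Pi.smul_apply, axialSeries, axialSeries, hs, h, h]
  module

theorem iterate_laplacian_axialSeries {E : Type*} [NormedAddCommGroup E] [InnerProductSpace ℝ E]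
    [FiniteDimensional ℝ E] {b : ℕ → ℝ} (hb : RapidDecay b) {e : E} (he : ‖e‖ = 1) (j i : ℕ) :
    (Laplacian.laplacian : (E → E) → E → E)^[i] (axialSeries e j b) =
      axialSeries e (j + i) ((∏ l ∈ Finset.range i,
        (2 * (j + l : ℕ) * (2 * (j + l : ℕ) - Module.finrank ℝ E) : ℝ)) • shift (2 * i) b) := by
  induction i with
  | zero =>
    have h0 : shift 0 b = b := rfl
    simp [h0]
  | succ i ih =>
    rw [Function.iterate_succ_apply', ih, laplacian_axialSeries ((hb.shift _).const_smul _) he,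
      ← axialSeries_smul, Finset.prod_range_succ]
    congr 1
    funext m
    simp only [Pi.smul_apply, smul_eq_mul, shift, show m + 2 + 2 * i = m + 2 * (i + 1) by ring]
    ring

/-- The factors of the `h` successive Laplacians in dimension `n + 1 = 2 h + 2`. -/
theorem prod_laplacian_factors (h : ℕ) :
    ∏ l ∈ Finset.range h, (2 * (1 + l : ℕ) * (2 * (1 + l : ℕ) - ((2 * h + 1 + 1 : ℕ) : ℝ)) : ℝ)
      = (-1) ^ h * ((2 * h).doubleFactorial : ℝ) ^ 2 := by
  have h1 : ∏ l ∈ Finset.range h, ((l + 1 : ℕ) : ℝ) = h.factorial := by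
    rw [← Nat.cast_prod, Finset.prod_range_add_one_eq_factorial]
  have h2 : ∏ l ∈ Finset.range h, ((h - l : ℕ) : ℝ) = h.factorial := by
    rw [← Nat.cast_prod, ← Nat.descFactorial_eq_prod_range, Nat.descFactorial_self]
  have h3 : ∀ l ∈ Finset.range h,
      (2 * (1 + l : ℕ) * (2 * (1 + l : ℕ) - ((2 * h + 1 + 1 : ℕ) : ℝ)) : ℝ)
        = -1 * (2 ^ 2) * (((l + 1 : ℕ) : ℝ) * ((h - l : ℕ) : ℝ)) := fun l hl => by
    rw [Nat.cast_sub (Finset.mem_range.1 hl).le]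
    push_cast
    ring
  rw [Finset.prod_congr rfl h3, Finset.prod_mul_distrib, Finset.prod_mul_distrib,
    Finset.prod_mul_distrib, h1, h2,
    Finset.prod_const, Finset.card_range, Nat.doubleFactorial_two_mul]
  push_cast
  simp only [Finset.prod_const, Finset.card_range, mul_pow, ← pow_mul]
  ring

/-! ### Generating functions -/

section
open PowerSeries

theorem mk_choose_mul_pow_mul_one_sub {A : Type*} [CommRing A] (z : A) (d : ℕ) :
    (mk fun k => ((d + k).choose d : A) * z ^ k) * (1 - C z * X) ^ (d + 1) = 1 := by
  have h := congrArg (rescale z) (mk_add_choose_mul_one_sub_pow_eq_one A d)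
  simpa [rescale_mk, rescale_X, mul_comm] using h

/-- The recursion in `j`, as an identity of power series with `Q = (1 - z X)(1 - z̄ X)`. -/
theorem mk_gegenbauer_succ (z : ℂ) (j : ℕ) :
    ((1 - C z * X) * (1 - C (conj z) * X))
        * (mk fun m => (gegenbauer z.re (Complex.normSq z) (j + 1) (m + 2) : ℂ))
      = mk fun m => (gegenbauer z.re (Complex.normSq z) j (m + 2) : ℂ) := by
  have hz : z + conj z = ((2 * z.re : ℝ) : ℂ) := Complex.add_conj z
  have hz' : z * conj z = ((Complex.normSq z : ℝ) : ℂ) := Complex.mul_conj z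
  have hQ : (1 - C z * X) * (1 - C (conj z) * X) =
      1 - C ((2 * z.re : ℝ) : ℂ) * X + C ((Complex.normSq z : ℝ) : ℂ) * X ^ 2 := by
    rw [← hz, ← hz', map_add, map_mul]; ring
  ext m
  rw [hQ, add_mul, sub_mul, one_mul, mul_assoc, mul_assoc, map_add, map_sub, coeff_C_mul,
    coeff_C_mul]
  have h := gegenbauer.succ_eq z.re (Complex.normSq z) j (m + 2)
  rcases m with _ | _ | m
  · have : gegenbauer z.re (Complex.normSq z) (j + 1) 2
        = gegenbauer z.re (Complex.normSq z) j 2 := by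
      simpa using h
    simp [coeff_zero_X_mul, coeff_X_pow_mul', this]
  · have : gegenbauer z.re (Complex.normSq z) (j + 1) 3 = gegenbauer z.re (Complex.normSq z) j 3
        + 2 * z.re * gegenbauer z.re (Complex.normSq z) (j + 1) 2 := by
      simpa using h
    simp [coeff_succ_X_mul, coeff_X_pow_mul', this]
  · simp only [Nat.add_sub_cancel, show m + 1 + 1 + 2 - 1 = m + 1 + 2 by omega] at h
    simp only [coeff_succ_X_mul, coeff_X_pow_mul', coeff_mk]
    simp [h]
    ring

theorem pow_mul_mk_gegenbauer (z : ℂ) (j : ℕ) :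
    ((1 - C z * X) * (1 - C (conj z) * X)) ^ j
        * (mk fun m => (gegenbauer z.re (Complex.normSq z) j (m + 2) : ℂ)) = 1 := by
  induction j with
  | zero =>
    ext m
    simp only [gegenbauer, pow_zero, one_mul, coeff_mk, coeff_one, Nat.add_eq_right]
    split_ifs <;> simp
  | succ j ih => rw [pow_succ, mul_assoc, mk_gegenbauer_succ, ih]

/-- The coefficients of `(1 - t z̄) Q⁻ʲ = (1 - t z)⁻ʲ (1 - t z̄)⁻⁽ʲ⁻¹⁾` for `j = d + 2`, where
`Q = (1 - t z)(1 - t z̄)`. -/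
theorem gegenbauer_sub_mul_conj (z : ℂ) (d m : ℕ) :
    (gegenbauer z.re (Complex.normSq z) (d + 2) (m + 2) : ℂ)
        - gegenbauer z.re (Complex.normSq z) (d + 2) (m + 1) * conj z
      = ∑ s ∈ Finset.range (m + 1), ((d + 1 + (m - s)).choose (d + 1) : ℂ)
          * ((d + s).choose d : ℂ) * (z ^ (m - s) * conj z ^ s) := by
  have h1 := mk_choose_mul_pow_mul_one_sub z (d + 1)
  have h2 := mk_choose_mul_pow_mul_one_sub (conj z) d
  have h3 := pow_mul_mk_gegenbauer z (d + 2)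
  set P := (mk fun k => ((d + 1 + k).choose (d + 1) : ℂ) * z ^ k)
  set P' := (mk fun k => ((d + k).choose d : ℂ) * conj z ^ k)
  set G := (mk fun m => (gegenbauer z.re (Complex.normSq z) (d + 2) (m + 2) : ℂ)) with hG
  have key : (1 - C (conj z) * X) * G = P' * P := by
    refine (left_inv_eq_right_inv (a := (1 - C z * X) ^ (d + 2) * (1 - C (conj z) * X) ^ (d + 1))
      ?_ ?_).symm
    · linear_combination (P * (1 - C z * X) ^ (d + 1 + 1)) * h2 + h1
    · rw [mul_pow] at h3
      linear_combination h3
  have hm := congrArg (coeff m) key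
  rw [sub_mul, one_mul, map_sub, mul_assoc, coeff_C_mul, coeff_mul m P' P,
    Finset.Nat.sum_antidiagonal_eq_sum_range_succ_mk] at hm
  have hc : coeff m (X * G) = (gegenbauer z.re (Complex.normSq z) (d + 2) (m + 1) : ℂ) := by
    cases m with
    | zero => rw [coeff_zero_X_mul, gegenbauer.apply_one, Complex.ofReal_zero]
    | succ m => rw [coeff_succ_X_mul, hG, coeff_mk]
  rw [hc, hG, coeff_mk, mul_comm] at hm
  rw [hm]
  refine Finset.sum_congr rfl fun s _ => ?_
  simp only [P, P', coeff_mk]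
  ring

end

/-- The case `j = 1`, where `(1 - t z̄) Q⁻¹` is the geometric series. -/
theorem gegenbauer_one_sub_mul_conj (z : ℂ) (m : ℕ) :
    (gegenbauer z.re (Complex.normSq z) 1 (m + 2) : ℂ)
        - gegenbauer z.re (Complex.normSq z) 1 (m + 1) * conj z = z ^ m := by
  have hz : z + conj z = ((2 * z.re : ℝ) : ℂ) := Complex.add_conj z
  have hz' : z * conj z = ((Complex.normSq z : ℝ) : ℂ) := Complex.mul_conj z
  induction m with
  | zero => simp [gegenbauer]
  | succ m ih =>
    rw [pow_succ, ← ih]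
    have h : gegenbauer z.re (Complex.normSq z) 1 (m + 1 + 2) =
        2 * z.re * gegenbauer z.re (Complex.normSq z) 1 (m + 2)
          - Complex.normSq z * gegenbauer z.re (Complex.normSq z) 1 (m + 1) := by
      simp [gegenbauer]
    rw [h]
    push_cast at hz ⊢
    rw [← hz, ← hz']
    ring

theorem eval_ascPochhammer_nat_succ (N k : ℕ) :
    (ascPochhammer ℝ k).eval ((N : ℝ) + 1) = k.factorial * ((N + k).choose N : ℝ) := by
  have h := ascPochhammer_eval_cast ℝ k (N + 1)
  rw [ascPochhammer_nat_eq_ascFactorial, Nat.ascFactorial_eq_factorial_mul_choose] at h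
  push_cast at h
  rw [← h, Nat.choose_symm_add]

/-- For `n = 2 (d + 1) + 1` both half-integer parameters of the Appell coefficients are integers,
and `binom(k + n - 1, n - 1) T_s^k` is a product of two binomial coefficients. -/
theorem choose_mul_appellCoeff (d k s : ℕ) :
    ((2 * (d + 1) + k).choose (2 * (d + 1)) : ℝ) * FueterSce.appellCoeff (2 * (d + 1) + 1) k s
      = ((d + 1 + (k - s)).choose (d + 1) : ℝ) * ((d + s).choose d : ℝ) := by
  have e1 : (((2 * (d + 1) + 1 : ℕ) : ℝ) + 1) / 2 = ((d + 1 : ℕ) : ℝ) + 1 := by push_cast; ring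
  have e2 : (((2 * (d + 1) + 1 : ℕ) : ℝ) - 1) / 2 = (d : ℝ) + 1 := by push_cast; ring
  have e3 : ((2 * (d + 1) + 1 : ℕ) : ℝ) = ((2 * (d + 1) : ℕ) : ℝ) + 1 := by push_cast; ring
  rw [FueterSce.appellCoeff, e1, e2, e3, eval_ascPochhammer_nat_succ, eval_ascPochhammer_nat_succ,
    eval_ascPochhammer_nat_succ]
  have c : ((2 * (d + 1) + k).choose (2 * (d + 1)) : ℝ) ≠ 0 :=
    Nat.cast_ne_zero.2 (Nat.choose_pos (by omega)).ne'
  have f1 : (k.factorial : ℝ) ≠ 0 := Nat.cast_ne_zero.2 (Nat.factorial_ne_zero _)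
  have f2 : ((k - s).factorial : ℝ) ≠ 0 := Nat.cast_ne_zero.2 (Nat.factorial_ne_zero _)
  have f3 : (s.factorial : ℝ) ≠ 0 := Nat.cast_ne_zero.2 (Nat.factorial_ne_zero _)
  field_simp

/-! ### Paravectors and axial series -/

variable {n : ℕ}

/-- The paravector `1`. -/
noncomputable abbrev realUnit (n : ℕ) : EuclideanSpace ℝ (Fin (n + 1)) := EuclideanSpace.single 0 1

theorem norm_realUnit (n : ℕ) : ‖realUnit n‖ = 1 := by simp [realUnit]

theorem inner_realUnit (x : EuclideanSpace ℝ (Fin (n + 1))) : ⟪realUnit n, x⟫_ℝ = x 0 := by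
  simp [realUnit, EuclideanSpace.inner_single_left]

/-- The complex number `x₀ + i |𝐱|` attached to the paravector `x`. -/
noncomputable def axialPoint (x : EuclideanSpace ℝ (Fin (n + 1))) : ℂ := ⟨x 0, ‖vecPart x‖⟩

theorem normSq_axialPoint (x : EuclideanSpace ℝ (Fin (n + 1))) :
    Complex.normSq (axialPoint x) = ‖x‖ ^ 2 := by
  rw [Complex.normSq_apply, axialPoint, EuclideanSpace.norm_sq_eq, Fin.sum_univ_succ, ← sq, ← sq,
    EuclideanSpace.norm_sq_eq]
  simp [vecPart]

/-- The embedding `para` as a linear map. -/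
noncomputable def paraₗ (n : ℕ) : EuclideanSpace ℝ (Fin (n + 1)) →ₗ[ℝ] Cl n where
  toFun := para
  map_add' x y := by
    have : (vecPart (x + y)).ofLp = (vecPart x).ofLp + (vecPart y).ofLp := rfl
    simp only [para, this, map_add, PiLp.add_apply]
    abel
  map_smul' c x := by
    have : (vecPart (c • x)).ofLp = c • (vecPart x).ofLp := rfl
    rw [para, para, this, map_smul, PiLp.smul_apply, smul_eq_mul, RingHom.id_apply, smul_add,
      Algebra.smul_def c (algebraMap ℝ (Cl n) _), map_mul]

theorem continuous_para : Continuous (para : EuclideanSpace ℝ (Fin (n + 1)) → Cl n) := by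
  have : IsTopologicalAddGroup (Cl n) := IsModuleTopology.topologicalAddGroup ℝ (Cl n)
  have : ContinuousSMul ℝ (Cl n) := IsModuleTopology.toContinuousSMul ℝ (Cl n)
  exact (paraₗ n).continuous_of_finiteDimensional

theorem algebraMap_injective : Function.Injective (algebraMap ℝ (Cl n)) := by
  have : Nontrivial (Cl n) := (CliffordAlgebra.equivExterior (negSq n)).toEquiv.nontrivial
  exact FaithfulSMul.algebraMap_injective ℝ (Cl n)

theorem para_reflect (x : EuclideanSpace ℝ (Fin (n + 1))) :
    para (reflect (realUnit n) x) = paraConj x := by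
  have h : (vecPart (reflect (realUnit n) x)).ofLp = - (vecPart x).ofLp := by
    funext i
    simp [vecPart, reflect_apply, realUnit]
  rw [para, h, map_neg, ← sub_eq_add_neg, paraConj, reflect_apply, inner_realUnit]
  congr 2
  simp [realUnit]
  ring

theorem para_smul_realUnit (c : ℝ) : para (c • realUnit n) = algebraMap ℝ (Cl n) c := by
  have h : (vecPart (c • realUnit n)).ofLp = 0 := by
    funext i
    simp [vecPart, realUnit]
  simp [para, h]

theorem ι_mul_self (ω : EuclideanSpace ℝ (Fin n)) (hω : ‖ω‖ = 1) :
    CliffordAlgebra.ι (negSq n) ω.ofLp * CliffordAlgebra.ι (negSq n) ω.ofLp = -1 := by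
  rw [CliffordAlgebra.ι_sq_scalar]
  have : negSq n ω.ofLp = -1 := by
    have h := EuclideanSpace.norm_sq_eq ω
    rw [hω] at h
    simp only [Real.norm_eq_abs, sq_abs] at h
    rw [negSq, QuadraticMap.weightedSumSquares_apply]
    simp only [neg_smul, one_smul, Finset.sum_neg_distrib, ← sq, ← h, one_pow]
  rw [this, map_neg, map_one]

/-- A paravector and its conjugate lie in a copy of `ℂ` in the Clifford algebra, generated by a unit
vector `ω` parallel to `𝐱`. -/
theorem exists_algHom_axialPoint (hn : 0 < n) (x : EuclideanSpace ℝ (Fin (n + 1))) :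
    ∃ φ : ℂ →ₐ[ℝ] Cl n, φ (axialPoint x) = para x ∧ φ (conj (axialPoint x)) = paraConj x := by
  obtain ⟨ω, hω, hx⟩ : ∃ ω : EuclideanSpace ℝ (Fin n), ‖ω‖ = 1 ∧ vecPart x = ‖vecPart x‖ • ω := by
    rcases eq_or_ne (vecPart x) 0 with h | h
    · -- Any unit vector will do when `𝐱 = 0`.
      exact ⟨EuclideanSpace.single ⟨0, hn⟩ 1, by simp, by simp [h]⟩
    · exact ⟨‖vecPart x‖⁻¹ • vecPart x, norm_smul_inv_norm h, by
        rw [smul_inv_smul₀ (norm_ne_zero_iff.2 h)]⟩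
  have hx' : (vecPart x).ofLp = ‖vecPart x‖ • ω.ofLp := congrArg WithLp.ofLp hx
  refine ⟨Complex.liftAux _ (ι_mul_self ω hω), ?_, ?_⟩
  · rw [Complex.liftAux_apply, para, hx', map_smul]
    rfl
  · rw [Complex.liftAux_apply, paraConj, hx', map_smul, Complex.conj_re, Complex.conj_im, neg_smul,
      ← sub_eq_add_neg]
    rfl

/-- The `m`-th term of the axial series with `j = (n + 1) / 2` is a multiple of the Appell
polynomial. -/
theorem para_axial_term (d m : ℕ) (x : EuclideanSpace ℝ (Fin (2 * (d + 1) + 1 + 1))) :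
    para (gegenbauer (x 0) (‖x‖ ^ 2) (d + 2) (m + 2) • realUnit (2 * (d + 1) + 1)
        - gegenbauer (x 0) (‖x‖ ^ 2) (d + 2) (m + 1) • reflect (realUnit (2 * (d + 1) + 1)) x)
      = ((2 * (d + 1) + m).choose (2 * (d + 1)) : ℝ) • appell (2 * (d + 1) + 1) m x := by
  obtain ⟨φ, hφ, hφ'⟩ := exists_algHom_axialPoint (by omega) x
  have h := congrArg φ (gegenbauer_sub_mul_conj (axialPoint x) d m)
  have hre : (axialPoint x).re = x 0 := rfl
  have hcoe : ∀ c : ℝ, φ (c : ℂ) = algebraMap ℝ (Cl (2 * (d + 1) + 1)) c := fun c => φ.commutes c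
  rw [normSq_axialPoint, hre, map_sub, map_mul, hcoe, hcoe, hφ', map_sum] at h
  change paraₗ _ _ = _
  rw [map_sub, map_smul (paraₗ _) _ (reflect _ x)]
  change para _ - _ • para _ = _
  rw [para_smul_realUnit, para_reflect, Algebra.smul_def, h, appell, Finset.smul_sum]
  refine Finset.sum_congr rfl fun s _ => ?_
  have hc : φ (((d + 1 + (m - s)).choose (d + 1) : ℂ) * ((d + s).choose d : ℂ)) =
      algebraMap ℝ _ (((d + 1 + (m - s)).choose (d + 1) : ℝ) * ((d + s).choose d : ℝ)) := by
    rw [← hcoe]; push_cast; rfl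
  rw [map_mul, hc, map_mul φ, map_pow, map_pow, hφ, hφ', smul_smul, choose_mul_appellCoeff,
    ← Algebra.smul_def]

theorem hasSum_axialSeries {b : ℕ → ℝ} (hb : RapidDecay b) (j : ℕ)
    (x : EuclideanSpace ℝ (Fin (n + 1))) :
    HasSum (fun m => b m • (gegenbauer (x 0) (‖x‖ ^ 2) j (m + 2) • realUnit n
        - gegenbauer (x 0) (‖x‖ ^ 2) j (m + 1) • reflect (realUnit n) x))
      (axialSeries (realUnit n) j b x) := by
  have h := ((hasSum_gegSeries hb (norm_realUnit n) j x).smul_const (realUnit n)).sub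
    ((gegSeries_shift_one hb (norm_realUnit n) j x).smul_const (reflect (realUnit n) x))
  refine h.congr_fun fun m => ?_
  rw [inner_realUnit, smul_sub, smul_smul, smul_smul]

theorem hasSum_appell {b : ℕ → ℝ} (hb : RapidDecay b) (d : ℕ)
    (x : EuclideanSpace ℝ (Fin (2 * (d + 1) + 1 + 1))) :
    HasSum (fun m => (b m * (2 * (d + 1) + m).choose (2 * (d + 1))) • appell (2 * (d + 1) + 1) m x)
      (para (axialSeries (realUnit _) (d + 2) b x)) := by
  have h := (hasSum_axialSeries hb (d + 2) x).map (paraₗ _) continuous_para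
  refine h.congr_fun fun m => ?_
  rw [Function.comp_apply, map_smul, mul_smul, ← para_axial_term]
  rfl

/-- The series with `j = 1` is the power series of `f` in the paravector variable. It is a sum of
polynomials also across the axis `𝐱 = 0`. -/
theorem axialSeries_one {f : ℂ → ℂ} {b : ℕ → ℝ} (hb : RapidDecay b)
    (hf : ∀ z : ℂ, HasSum (fun m => (b m : ℂ) * z ^ m) (f z)) :
    axialSeries (realUnit n) 1 b = axialField n f := by
  funext x
  set S := gegSeries (realUnit n) 1 b x with hS
  set S' := gegSeries (realUnit n) 1 (shift 1 b) x with hS'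
  have h1 : HasSum (fun m => (b m : ℂ) * axialPoint x ^ m) (S - S' * conj (axialPoint x)) := by
    have h := (Complex.hasSum_ofReal.2 (hasSum_gegSeries hb (norm_realUnit n) 1 x)).sub
      ((Complex.hasSum_ofReal.2 (gegSeries_shift_one hb (norm_realUnit n) 1 x)).mul_right
        (conj (axialPoint x)))
    refine h.congr_fun fun m => ?_
    rw [← gegenbauer_one_sub_mul_conj, normSq_axialPoint, inner_realUnit]
    simp only [axialPoint]
    push_cast
    ring
  have hF : f (axialPoint x) = S - S' * conj (axialPoint x) := (hf _).unique h1
  have hF' : f ⟨x 0, ‖vecPart x‖⟩ = S - S' * conj (axialPoint x) := hF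
  ext i
  rw [axialSeries, ← hS, ← hS', reflect_apply, inner_realUnit, axialField]
  simp only [hF']
  refine Fin.cases ?_ (fun i => ?_) i
  · simp only [Fin.cons_zero, Complex.sub_re, Complex.ofReal_re, Complex.re_ofReal_mul,
      Complex.conj_re, axialPoint, realUnit, PiLp.sub_apply, PiLp.smul_apply, smul_eq_mul,
      PiLp.single_apply, if_true]
    ring
  · rcases eq_or_ne (vecPart x) 0 with h | h
    · have hi : x i.succ = 0 := congrArg (fun v : EuclideanSpace ℝ (Fin n) => v i) h
      simp [axialPoint, realUnit, h, hi]
    · have h' : ‖vecPart x‖ ≠ 0 := norm_ne_zero_iff.2 h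
      have hi : vecPart x i = x i.succ := rfl
      simp [axialPoint, realUnit, hi]
      field_simp

/-! ### Comparison of coefficients -/

theorem eq_of_hasSum_mul_pow {p q : ℕ → ℝ} {s : ℝ → ℝ}
    (hp : ∀ t, HasSum (fun m => p m * t ^ m) (s t))
    (hq : ∀ t, HasSum (fun m => q m * t ^ m) (s t)) :
    p = q := by
  have key : ∀ r : ℕ → ℝ, (∀ t, HasSum (fun m => r m * t ^ m) (s t)) →
      HasFPowerSeriesAt s (FormalMultilinearSeries.ofScalars ℝ r) 0 := fun r hr => by
    rw [hasFPowerSeriesAt_iff]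
    refine Filter.Eventually.of_forall fun t => ?_
    simpa [mul_comm, FormalMultilinearSeries.coeff_ofScalars] using hr t
  have h := (key p hp).eq_formalMultilinearSeries (key q hq)
  exact FormalMultilinearSeries.ofScalars_series_injective ℝ ℝ h

/-- The values on the real axis already determine the coefficients: there the conjugation is
trivial, and the `m`-th term of the axial series is a positive multiple of `tᵐ`. -/
theorem para_axialSeries_injective {p q : ℕ → ℝ} (hp : RapidDecay p) (hq : RapidDecay q) {n : ℕ}
    (d : ℕ)
    (h : ∀ x, para (axialSeries (realUnit n) (d + 2) p x)
      = para (axialSeries (realUnit n) (d + 2) q x)) :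
    p = q := by
  let κ : ℕ → ℝ := fun m => ∑ s ∈ Finset.range (m + 1),
    ((d + 1 + (m - s)).choose (d + 1) : ℝ) * ((d + s).choose d : ℝ)
  have hκ : ∀ m, κ m ≠ 0 := fun m => by
    refine (Finset.sum_pos (fun s _ => ?_) ⟨0, by simp⟩).ne'
    exact mul_pos (Nat.cast_pos.2 (Nat.choose_pos (by omega)))
      (Nat.cast_pos.2 (Nat.choose_pos (by omega)))
  have hterm : ∀ (t : ℝ) (m : ℕ), gegenbauer t (t ^ 2) (d + 2) (m + 2)
      - gegenbauer t (t ^ 2) (d + 2) (m + 1) * t = κ m * t ^ m := fun t m => by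
    have hz := gegenbauer_sub_mul_conj (t : ℂ) d m
    rw [Complex.normSq_ofReal, Complex.conj_ofReal, Complex.ofReal_re, ← sq] at hz
    have : ∀ s ∈ Finset.range (m + 1), ((d + 1 + (m - s)).choose (d + 1) : ℂ)
        * ((d + s).choose d : ℂ) * ((t : ℂ) ^ (m - s) * (t : ℂ) ^ s)
        = ((d + 1 + (m - s)).choose (d + 1) : ℂ) * ((d + s).choose d : ℂ) * (t : ℂ) ^ m :=
      fun s hs => by
        rw [← pow_add, Nat.sub_add_cancel (Nat.lt_succ_iff.1 (Finset.mem_range.1 hs))]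
    rw [Finset.sum_congr rfl this, ← Finset.sum_mul] at hz
    simp only [κ]
    exact_mod_cast hz
  have hrefl : ∀ t : ℝ, reflect (realUnit n) (t • realUnit n) = t • realUnit n := fun t => by
    rw [reflect_apply, inner_smul_right, real_inner_self_eq_norm_sq, norm_realUnit]
    module
  have hsum : ∀ {b : ℕ → ℝ}, RapidDecay b → ∀ t : ℝ, HasSum (fun m => (b m * κ m) * t ^ m)
      (axialSeries (realUnit n) (d + 2) b (t • realUnit n) 0) := fun {b} hb t => by
    have hs := (hasSum_axialSeries hb (d + 2) (t • realUnit n)).mapL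
      (EuclideanSpace.proj (𝕜 := ℝ) (0 : Fin (n + 1)))
    refine hs.congr_fun fun m => ?_
    have h0 : (t • realUnit n) 0 = t := by simp [realUnit]
    have hn : ‖t • realUnit n‖ ^ 2 = t ^ 2 := by
      rw [norm_smul, norm_realUnit, mul_one, Real.norm_eq_abs, sq_abs]
    rw [h0, hn, hrefl, smul_smul, ← sub_smul, hterm, map_smul, map_smul]
    simp [realUnit, mul_assoc]
  have hval : ∀ (b : ℕ → ℝ) (t : ℝ), para (axialSeries (realUnit n) (d + 2) b (t • realUnit n))
      = algebraMap ℝ (Cl n) (axialSeries (realUnit n) (d + 2) b (t • realUnit n) 0) := fun b t => by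
    have : axialSeries (realUnit n) (d + 2) b (t • realUnit n)
        = (axialSeries (realUnit n) (d + 2) b (t • realUnit n) 0) • realUnit n := by
      rw [axialSeries, hrefl, smul_smul, ← sub_smul]
      simp [realUnit]
    rw [← para_smul_realUnit, ← this]
  have hpq := eq_of_hasSum_mul_pow (hsum hp) fun t => by
    have e := algebraMap_injective (((hval p t).symm.trans (h _)).trans (hval q t))
    rw [e]
    exact hsum hq t
  funext m
  exact mul_right_cancel₀ (hκ m) (congrFun hpq m)

theorem rapidDecay_of_hasSum {f : ℂ → ℂ} {a : ℕ → ℝ}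
    (hf : ∀ z : ℂ, HasSum (fun m => (a m : ℂ) * z ^ m) (f z)) : RapidDecay a := by
  intro R hR
  refine (hf R).summable.norm.congr fun m => ?_
  rw [norm_mul, norm_pow, Complex.norm_real, Complex.norm_real, Real.norm_eq_abs, Real.norm_eq_abs,
    abs_of_pos hR]

/-- The Fueter–Sce extension as an axial series. -/
theorem fueterSce_eq (d : ℕ) (α : ℝ) {f : ℂ → ℂ} {a : ℕ → ℝ}
    (hf : ∀ z : ℂ, HasSum (fun m => (a m : ℂ) * z ^ m) (f z))
    (x : EuclideanSpace ℝ (Fin (2 * (d + 1) + 1 + 1))) :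
    fueterSce (2 * (d + 1) + 1) α f x = para (axialSeries (realUnit _) (d + 2)
      ((α * ((-1) ^ (d + 1) * ((2 * (d + 1)).doubleFactorial : ℝ) ^ 2)) • shift (2 * (d + 1)) a)
        x) := by
  have ha := rapidDecay_of_hasSum hf
  have hi : (2 * (d + 1) + 1 - 1) / 2 = d + 1 := by omega
  rw [fueterSce, hi, ← axialSeries_one ha hf, iterate_laplacian_axialSeries ha (norm_realUnit _),
    finrank_euclideanSpace_fin, prod_laplacian_factors, mul_smul α,
    axialSeries_smul _ _ α, Pi.smul_apply, show 1 + (d + 1) = d + 2 by ring]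
  exact (map_smul (paraₗ _) α _).symm

theorem RapidDecay.div_choose {b : ℕ → ℝ} (hb : RapidDecay b) (N : ℕ) :
    RapidDecay fun m => b m / (N + m).choose N := by
  intro R hR
  refine Summable.of_nonneg_of_le (fun m => by positivity) (fun m => ?_) (hb R hR)
  rw [abs_div, Nat.abs_cast]
  gcongr
  exact div_le_self (abs_nonneg _) (by exact_mod_cast Nat.choose_pos (Nat.le_add_right N m))

/-- The series of the Appell extension converges, and its sum is an axial series. -/
theorem hasSum_smul_appell (d : ℕ) {a : ℕ → ℝ} (ha : RapidDecay a)
    (x : EuclideanSpace ℝ (Fin (2 * (d + 1) + 1 + 1))) :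
    HasSum (fun k => a k • appell (2 * (d + 1) + 1) k x)
      (para (axialSeries (realUnit _) (d + 2)
        (fun m => a m / (2 * (d + 1) + m).choose (2 * (d + 1))) x)) := by
  refine (hasSum_appell (ha.div_choose _) d x).congr_fun fun m => ?_
  rw [div_mul_cancel₀ _ (Nat.cast_ne_zero.2 (Nat.choose_pos (Nat.le_add_right _ m)).ne')]

/-- Equality of the `k`-th coefficients of the two extensions is the recurrence at `k`; the double
factorials enter through `(2h)! = (2h)‼ (2h - 1)‼`. -/
theorem recurrence_iff (h : ℕ) (hh : 0 < h) {α : ℝ} (hα : α ≠ 0) (k : ℕ) (A B : ℝ) :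
    α * ((-1) ^ h * ((2 * h).doubleFactorial : ℝ) ^ 2) * A = B / (2 * h + k).choose (2 * h) ↔
      A = ((-1 : ℝ) ^ h * ((2 * h - 1).doubleFactorial : ℝ) / (((2 * h).doubleFactorial : ℝ) * α))
            * (k.factorial : ℝ) / ((k + 2 * h).factorial : ℝ) * B := by
  have hD : ((2 * h).factorial : ℝ) = (2 * h).doubleFactorial * (2 * h - 1).doubleFactorial := by
    obtain ⟨m, hm⟩ : ∃ m, 2 * h = m + 1 := ⟨2 * h - 1, by omega⟩
    rw [hm, Nat.factorial_eq_mul_doubleFactorial]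
    simp
  have hC : ((2 * h + k).choose (2 * h) : ℝ) * (2 * h).factorial * k.factorial
      = (k + 2 * h).factorial := by
    rw [add_comm k, Nat.choose_symm_add]
    exact_mod_cast Nat.add_choose_mul_factorial_mul_factorial (2 * h) k
  have h1 : ((2 * h).doubleFactorial : ℝ) ≠ 0 :=
    Nat.cast_ne_zero.2 (Nat.doubleFactorial_pos _).ne'
  have h2 : ((2 * h - 1).doubleFactorial : ℝ) ≠ 0 :=
    Nat.cast_ne_zero.2 (Nat.doubleFactorial_pos _).ne'
  have h3 : ((2 * h + k).choose (2 * h) : ℝ) ≠ 0 :=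
    Nat.cast_ne_zero.2 (Nat.choose_pos (by omega)).ne'
  have h4 : (k.factorial : ℝ) ≠ 0 := Nat.cast_ne_zero.2 (Nat.factorial_ne_zero _)
  have hs : ((-1 : ℝ) ^ h) * (-1) ^ h = 1 := by rw [← mul_pow]; simp
  rw [← hC, hD]
  have hs0 : (-1 : ℝ) ^ h ≠ 0 := by positivity
  generalize (-1 : ℝ) ^ h = σ at *
  generalize ((2 * h + k).choose (2 * h) : ℝ) = c at *
  field_simp
  have hσ : σ ^ 2 = 1 := by rw [sq, hs]
  constructor
  · intro e
    linear_combination σ * e - (α * ((2 * h).doubleFactorial : ℝ) ^ 2 * A * c) * hσ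
  · intro e
    linear_combination σ * e + B * hσ

end FueterSce

theorem theorem2 (n : ℕ) (hn : 1 < n) (hodd : Odd n) (f : ℂ → ℂ) (hf : Differentiable ℂ f)
    (a : ℕ → ℝ) (ha : ∀ k : ℕ, iteratedDeriv k f 0 / (k.factorial : ℂ) = (a k : ℂ)) :
    (∀ x : EuclideanSpace ℝ (Fin (n + 1)), Summable fun k : ℕ => a k • FueterSce.appell n k x) ∧
    (∀ α : ℝ, α ≠ 0 →
      ((∀ x : EuclideanSpace ℝ (Fin (n + 1)),
          FueterSce.fueterSce n α f x = FueterSce.appellExt n a x) ↔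
        ∀ k : ℕ, a (k + n - 1) =
          ((-1 : ℝ) ^ ((n - 1) / 2) * (Nat.doubleFactorial (n - 2) : ℝ)
              / ((Nat.doubleFactorial (n - 1) : ℝ) * α))
            * (k.factorial : ℝ) / ((k + n - 1).factorial : ℝ) * a k)) ∧
    ((∃ α : ℝ, α ≠ 0 ∧ ∀ x : EuclideanSpace ℝ (Fin (n + 1)),
          FueterSce.fueterSce n α f x = FueterSce.appellExt n a x) ↔
      ∃ γ : ℝ, γ ≠ 0 ∧ ∀ k : ℕ, a (k + n - 1) =
          γ * (k.factorial : ℝ) / ((k + n - 1).factorial : ℝ) * a k) := by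
  obtain ⟨d, rfl⟩ : ∃ d, n = 2 * (d + 1) + 1 := by
    obtain ⟨h, rfl⟩ := hodd
    exact ⟨h - 1, by omega⟩
  have hsum : ∀ z : ℂ, HasSum (fun m => (a m : ℂ) * z ^ m) (f z) := fun z => by
    refine (Complex.hasSum_taylorSeries_of_entire hf 0 z).congr_fun fun m => ?_
    rw [← ha, sub_zero, smul_eq_mul, smul_eq_mul]
    ring
  have hdecay := FueterSce.rapidDecay_of_hasSum hsum
  have happ := FueterSce.hasSum_smul_appell d hdecay
  have hk : ∀ k, k + (2 * (d + 1) + 1) - 1 = k + 2 * (d + 1) := fun k => by omega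
  have hn1 : 2 * (d + 1) + 1 - 1 = 2 * (d + 1) := by omega
  have hn2 : 2 * (d + 1) + 1 - 2 = 2 * (d + 1) - 1 := by omega
  have hn3 : 2 * (d + 1) / 2 = d + 1 := by omega
  simp only [hk, hn1, hn2, hn3]
  have main : ∀ α : ℝ, α ≠ 0 →
      ((∀ x, FueterSce.fueterSce (2 * (d + 1) + 1) α f x
          = FueterSce.appellExt (2 * (d + 1) + 1) a x) ↔
        ∀ k : ℕ, a (k + 2 * (d + 1)) =
          ((-1 : ℝ) ^ (d + 1) * (Nat.doubleFactorial (2 * (d + 1) - 1) : ℝ)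
              / ((Nat.doubleFactorial (2 * (d + 1)) : ℝ) * α))
            * (k.factorial : ℝ) / ((k + 2 * (d + 1)).factorial : ℝ) * a k) := by
    intro α hα
    have heq : ∀ x, FueterSce.appellExt (2 * (d + 1) + 1) a x = _ :=
      fun x => (happ x).tsum_eq
    simp only [heq, FueterSce.fueterSce_eq d α hsum,
      ← FueterSce.recurrence_iff (d + 1) d.succ_pos hα]
    constructor
    · intro h
      exact congrFun (FueterSce.para_axialSeries_injective ((hdecay.shift _).const_smul _)
        (hdecay.div_choose _) d h)
    · intro h x
      congr 2
      exact funext h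
  refine ⟨fun x => (happ x).summable, main, ?_, ?_⟩
  · rintro ⟨α, hα, h⟩
    refine ⟨_, ?_, (main α hα).1 h⟩
    have := (Nat.doubleFactorial_pos (2 * (d + 1) - 1)).ne'
    have := (Nat.doubleFactorial_pos (2 * (d + 1))).ne'
    positivity
  · rintro ⟨γ, hγ, h⟩
    -- The first equivalence has `γ = c / α` for a nonzero constant `c`, so `α = c / γ` will do.
    have h1 : (Nat.doubleFactorial (2 * (d + 1) - 1) : ℝ) ≠ 0 :=
      Nat.cast_ne_zero.2 (Nat.doubleFactorial_pos _).ne'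
    have h2 : (Nat.doubleFactorial (2 * (d + 1)) : ℝ) ≠ 0 :=
      Nat.cast_ne_zero.2 (Nat.doubleFactorial_pos _).ne'
    have hα : (-1 : ℝ) ^ (d + 1) * (Nat.doubleFactorial (2 * (d + 1) - 1) : ℝ)
        / ((Nat.doubleFactorial (2 * (d + 1)) : ℝ) * γ) ≠ 0 := by positivity
    refine ⟨_, hα, (main _ hα).2 fun k => ?_⟩
    rw [h k]
    congr 3
    field_simp
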